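/- **Setting.** Let $k\ge m\ge 1$ be integers and let $\mathcal P$ be a set of at least two pages. A *cache configuration* is a function $C$ assigning to each slot $s\in[k]=\{1,\dots,k\}$ either a page of $\mathcal P$ or "empty". A *request* of One-out-of-$m$ Paging is a pair $(p,S)$ with $p\in\mathcal P$ and $S\subseteq[k]$, $|S|=m$; a configuration $C$ *satisfies* it if $C(s)=p$ for some $s\in S$. A *solution* for a finite request sequence $\sigma=(\sigma_1,\dots,\sigma_T)$ is a sequence $C_1,\dots,C_T$ of configurations such that $C_t$ satisfies $\sigma_t$ for all $t$. Its *cost* is the number of retrievals, i.e. the number of pairs $(t,s)$ such that $C_t(s)$ is a page and $C_{t-1}(s)\neq C_t(s)$, where $C_0$ is the empty cache. Let $\mathrm{opt}(\sigma)$ be the minimum cost of a solution for $\sigma$. A *deterministic online algorithm* produces for every $\sigma$ a solution in which $C_t$ depends only on $\sigma_1,\dots,\sigma_t$; a *randomized online algorithm* is a probability distribution over deterministic online algorithms. A randomized online algorithm $\mathbb A$ is *$r$-competitive* ($r\ge 0$) if there is a constant $b$ such that $\mathbb E[\mathrm{cost}_{\mathbb A}(\sigma)]\le r\cdot\mathrm{opt}(\sigma)+b$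 for all request sequences $\sigma$. The *optimal randomized competitive ratio* is the infimum of all $r$ for which an $r$-competitive randomized online algorithm exists. **Theorem.** The optimal randomized competitive ratio of One-out-of-$m$ Paging with $k$ slots and $m=\lfloor k/2\rfloor$ is $\Omega(k)$: there are constants $c>0$ and $k_0$ such that for all $k\ge k_0$ and every set $\mathcal P$ of at least two pages, this ratio is at least $c\,k$. -/

import Mathlib

open MeasureTheory
open scoped ENNReal NNReal

noncomputable section

namespace SlotPaging

/-- A cache configuration: every one of the `k` slots holds a page or is empty (`none`). -/
abbrev Config (k : ℕ) (P : Type*) := Fin k → Option P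

/-- A request for slot-heterogenous paging with family `F` of requestable slot sets:
a page together with a slot set that belongs to `F`. -/
structure Request {k : ℕ} (F : Set (Finset (Fin k))) (P : Type*) where
  page : P
  slots : Finset (Fin k)
  mem : slots ∈ F

/-- The configuration assigns the requested page to at least one of the requested slots. -/
def Config.Satisfies {k : ℕ} {F : Set (Finset (Fin k))} {P : Type*}
    (C : Config k P) (r : Request F P) : Prop :=
  ∃ s ∈ r.slots, C s = some r.page

open Classical in
/-- The number of retrievals in a step from configuration `C` to configuration `C'`: the number of
slots that hold a page in `C'` and did not hold this page in `C`. -/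
def retrievals {k : ℕ} {P : Type*} (C C' : Config k P) : ℕ :=
  (Finset.univ.filter fun s : Fin k => C' s ≠ none ∧ C s ≠ C' s).card

/-- The number of retrievals during the first `T` steps of a sequence of configurations,
where `D t` is the configuration after the `t`-th request and `D 0` is the one before the first. -/
def totalCost {k : ℕ} {P : Type*} (D : ℕ → Config k P) (T : ℕ) : ℕ :=
  ∑ t ∈ Finset.range T, retrievals (D t) (D (t + 1))

/-- `D` is a solution for the request sequence `σ`: the cache is empty at the beginning (so that
every page that is present after the first step counts as a retrieval), and the configuration after
each request satisfies this request. The values `D t` with `t > σ.length` play no role. -/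
def IsSolution {k : ℕ} {F : Set (Finset (Fin k))} {P : Type*}
    (σ : List (Request F P)) (D : ℕ → Config k P) : Prop :=
  D 0 = (fun _ => none) ∧ ∀ (t : ℕ) (ht : t < σ.length), (D (t + 1)).Satisfies σ[t]

/-- The optimal (offline) cost of a request sequence. -/
def opt {k : ℕ} {F : Set (Finset (Fin k))} {P : Type*} (σ : List (Request F P)) : ℕ∞ :=
  ⨅ (D : ℕ → Config k P) (_ : IsSolution σ D), (totalCost D σ.length : ℕ∞)

/-- A deterministic online algorithm: the configuration after a request is a function of the
requests up to and including this one, and it satisfies this request. -/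
structure OnlineAlgorithm {k : ℕ} (F : Set (Finset (Fin k))) (P : Type*) where
  config : List (Request F P) → Config k P
  config_nil : config [] = fun _ => none
  satisfies : ∀ (σ : List (Request F P)) (r : Request F P), (config (σ ++ [r])).Satisfies r

/-- The number of retrievals that the algorithm makes on the request sequence `σ`. -/
def OnlineAlgorithm.cost {k : ℕ} {F : Set (Finset (Fin k))} {P : Type*}
    (A : OnlineAlgorithm F P) (σ : List (Request F P)) : ℕ :=
  totalCost (fun t => A.config (σ.take t)) σ.length

/-- The least σ-algebra for which the cost on every fixed request sequence is a random variable.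
Hence a random choice of an online algorithm, made on any probability space on which all these
costs are random variables, has a law on this measurable space. -/
instance {k : ℕ} {F : Set (Finset (Fin k))} {P : Type*} :
    MeasurableSpace (OnlineAlgorithm F P) :=
  ⨆ σ : List (Request F P), MeasurableSpace.comap (fun A => A.cost σ) ⊤

/-- A randomized online algorithm, that is a probability distribution `μ` on the deterministic
online algorithms, is `r`-competitive (against an oblivious adversary): its expected cost on every
request sequence is at most `r` times the optimal cost plus a constant that does not depend on the
request sequence. -/
def IsCompetitive {k : ℕ} {F : Set (Finset (Fin k))} {P : Type*}
    (μ : Measure (OnlineAlgorithm F P)) (r : ℝ≥0) : Prop :=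
  ∃ b : ℝ≥0, ∀ σ : List (Request F P),
    ∫⁻ A, (A.cost σ : ℝ≥0∞) ∂μ ≤ (r : ℝ≥0∞) * (opt σ : ℝ≥0∞) + (b : ℝ≥0∞)

/-- The optimal randomized competitive ratio of slot-heterogenous paging with family `F` of
requestable slot sets and pages from `P`: the infimum of all `r` for which there is an
`r`-competitive randomized online algorithm. -/
def optimalRandomizedRatio {k : ℕ} (F : Set (Finset (Fin k))) (P : Type*) : ℝ≥0∞ :=
  ⨅ (r : ℝ≥0) (_ : ∃ μ : Measure (OnlineAlgorithm F P), IsProbabilityMeasure μ ∧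
    IsCompetitive μ r), (r : ℝ≥0∞)

/-- The requestable slot sets of One-out-of-`m` Paging: all sets of exactly `m` slots. -/
def oneOutOf (k m : ℕ) : Set (Finset (Fin k)) := {S | S.card = m}

end SlotPaging

end

noncomputable section

namespace SlotPaging

open Finset

/-! ### Binary codes with many well-separated words -/

section Code

/-! The adversary hides a codeword of `d` bits, with `d` linear in `k`. Codewords are sets of `m`
slots inside a `2 * m`-set `U`, pairwise far apart (`exists_slotCode`); each stands for the
configuration with `p` on it and `q` on the rest of `U`. The requests common to all codewords with a
given prefix can only be met by agreeing on `U` with one of these codewords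
(`exists_eqOn_twoPageConfig`).

Each round extends the prefix by one bit. Whatever the current cache, the extra costs for the two
values of the bit sum to at least `d` (`IsSlotCode.cost_two_rounds`), so one value costs `d / 2` in
expectation. The adversary, who knows the distribution but not the random choices, picks that value.
A phase of `d` rounds thus costs `d * (d / 2)`, while the offline solution moves once to the final
codeword, for at most `k`. Repeated phases give a ratio of at least `d ^ 2 / (2 * k)`. -/

theorem card_hammingDist_lt_mul_le {m d : ℕ} (x : Fin m → Bool) :
    (univ.filter fun y : Fin m → Bool => hammingDist x y < d).card * 3 ^ m ≤ 4 ^ m * 3 ^ d := by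
  -- Weight each `y` by `3` to the number of agreements with `x`: the total is `4 ^ m`, and each
  -- word of the ball weighs at least `3 ^ m / 3 ^ d`.
  have total : ∑ y : Fin m → Bool, ∏ i, (if x i = y i then 3 else 1) = 4 ^ m := by
    have h := Finset.prod_univ_sum (fun _ : Fin m => (univ : Finset Bool))
      (fun i b => if x i = b then 3 else 1)
    rw [Fintype.piFinset_univ] at h
    rw [← h]
    have : ∀ i, ∑ b : Bool, (if x i = b then 3 else 1) = 4 := by
      intro i; cases h : x i <;> simp
    rw [prod_congr rfl fun i _ => this i]
    simp
  have term (y : Fin m → Bool) :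
      (∏ i, (if x i = y i then 3 else 1)) * 3 ^ hammingDist x y = 3 ^ m := by
    have : (3 : ℕ) ^ hammingDist x y = ∏ i, (if x i = y i then 1 else 3) := by
      rw [hammingDist, Finset.prod_ite]
      simp
    rw [this, ← Finset.prod_mul_distrib]
    have : ∀ i, (if x i = y i then 3 else 1) * (if x i = y i then 1 else 3) = 3 := by
      intro i; split_ifs <;> rfl
    simp [this]
  rw [← total, ← smul_eq_mul, ← Finset.sum_const, Finset.sum_mul]
  refine (Finset.sum_le_sum fun y hy => ?_).trans
    (Finset.sum_le_sum_of_subset (Finset.subset_univ _))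
  rw [← term y]
  exact Nat.mul_le_mul_left _ (Nat.pow_le_pow_right (by norm_num) (Finset.mem_filter.1 hy).2.le)

/-- Greedy Gilbert–Varshamov argument: balls around fewer than `2 ^ d` words cannot cover the cube.
-/
theorem exists_separated_finset {m d : ℕ} (hm : 5 * d ≤ m) (N : ℕ) (hN : N ≤ 2 ^ d) :
    ∃ s : Finset (Fin m → Bool), s.card = N ∧
      ∀ x ∈ s, ∀ y ∈ s, x ≠ y → d ≤ hammingDist x y := by
  induction N with
  | zero => exact ⟨∅, by simp⟩
  | succ N ih =>
    obtain ⟨s, hs, hsep⟩ := ih (by omega)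
    have hnot : ∃ z, ∀ x ∈ s, d ≤ hammingDist x z := by
      by_contra! h
      have hcover : (univ : Finset (Fin m → Bool)) ⊆
          s.biUnion fun x => univ.filter fun y => hammingDist x y < d := by
        intro z _
        obtain ⟨x, hx, hxz⟩ := h z
        exact mem_biUnion.2 ⟨x, hx, by simpa using hxz⟩
      have h1 := (card_le_card hcover).trans card_biUnion_le
      have h2 : 2 ^ m * 3 ^ m ≤ N * (4 ^ m * 3 ^ d) := by
        calc 2 ^ m * 3 ^ m ≤ (∑ x ∈ s, (univ.filter fun y => hammingDist x y < d).card) * 3 ^ m :=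
              Nat.mul_le_mul_right _ (by simpa using h1)
          _ ≤ ∑ x ∈ s, 4 ^ m * 3 ^ d := by
              rw [sum_mul]; exact sum_le_sum fun x _ => card_hammingDist_lt_mul_le x
          _ = _ := by simp [hs]
      have h3 : N * (4 ^ m * 3 ^ d) < 2 ^ d * (4 ^ m * 3 ^ d) :=
        Nat.mul_lt_mul_of_pos_right (by omega) (by positivity)
      -- The factor 5 in `hm` enters here, through `2 * 2 ^ 5 * 3 = 192 ≤ 243 = 3 ^ 5`.
      have h4 : 2 ^ d * (4 ^ m * 3 ^ d) ≤ 2 ^ m * 3 ^ m := by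
        obtain ⟨r, rfl⟩ := Nat.exists_eq_add_of_le hm
        have e4 : (4 : ℕ) ^ (5 * d + r) = 2 ^ (5 * d + r) * 2 ^ (5 * d + r) := by
          rw [← mul_pow]; norm_num
        have key : 2 ^ d * (2 ^ (5 * d + r) * 3 ^ d) ≤ 3 ^ (5 * d + r) := by
          calc 2 ^ d * (2 ^ (5 * d + r) * 3 ^ d) = 192 ^ d * 2 ^ r := by
                rw [pow_add, pow_mul, show (192 : ℕ) = 2 * (2 ^ 5 * 3) by norm_num, mul_pow 2,
                  mul_pow (2 ^ 5)]
                ring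
            _ ≤ 243 ^ d * 3 ^ r := by gcongr <;> norm_num
            _ = _ := by rw [pow_add, pow_mul]; norm_num
        rw [e4]
        calc _ = 2 ^ (5 * d + r) * (2 ^ d * (2 ^ (5 * d + r) * 3 ^ d)) := by ring
          _ ≤ _ := Nat.mul_le_mul_left _ key
      omega
    obtain ⟨z, hz⟩ := hnot
    rcases Nat.eq_zero_or_pos d with rfl | hd
    · obtain ⟨t, -, ht⟩ := exists_subset_card_eq (s := (univ : Finset (Fin m → Bool)))
        (n := N + 1) (by
          simp only [card_univ, Fintype.card_fun, Fintype.card_bool, Fintype.card_fin]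
          exact hN.trans (Nat.pow_le_pow_right (by norm_num) (by omega)))
      exact ⟨t, ht, by simp⟩
    have hzs : z ∉ s := fun h => by simpa using hd.trans_le (hz z h)
    refine ⟨insert z s, by simp [hzs, hs], ?_⟩
    intro x hx y hy hxy
    rcases mem_insert.1 hx with hx | hx <;> rcases mem_insert.1 hy with hy | hy
    · exact absurd (hx.trans hy.symm) hxy
    · rw [hammingDist_comm, hx]; exact hz _ hy
    · rw [hy]; exact hz _ hx
    · exact hsep _ hx _ hy hxy

/-- A constant-weight code of `2 ^ d` sets of `m` slots each. -/
theorem exists_slotCode {k m d : ℕ} (hk : 2 * m ≤ k) (hm : 5 * d ≤ m) :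
    ∃ (U : Finset (Fin k)) (A : (Fin d → Bool) → Finset (Fin k)), U.card = 2 * m ∧
      (∀ x, A x ⊆ U) ∧ (∀ x, (A x).card = m) ∧ ∀ x y, x ≠ y → d ≤ (A x \ A y).card := by
  obtain ⟨s, hs, hsep⟩ := exists_separated_finset hm (2 ^ d) le_rfl
  have f : (Fin d → Bool) ≃ s := Fintype.equivOfCardEq (by simp [hs])
  obtain ⟨e⟩ : Nonempty (Fin m × Bool ↪ Fin k) :=
    Function.Embedding.nonempty_of_card_le (by simp; omega)
  -- A word selects one slot from each of `m` pairs, so every set has size `m` and set difference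
  -- counts differing bits.
  let g (x : Fin m → Bool) : Fin m ↪ Fin k :=
    ⟨fun i => e (i, x i), fun i j h => congrArg Prod.fst (e.injective h)⟩
  refine ⟨univ.map e, fun x => univ.map (g (f x)), by simp; omega, ?_, by simp, ?_⟩
  · intro x t ht
    obtain ⟨i, -, rfl⟩ := mem_map.1 ht
    exact mem_map_of_mem e (mem_univ _)
  · intro x y hxy
    have hd := hsep _ (f x).2 _ (f y).2 (fun h => hxy (f.injective (Subtype.ext h)))
    refine hd.trans ?_
    rw [hammingDist, ← card_map (g (f x))]
    refine card_le_card fun t ht => ?_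
    obtain ⟨i, hi, rfl⟩ := mem_map.1 ht
    refine mem_sdiff.2 ⟨mem_map_of_mem _ (mem_univ _), fun h => ?_⟩
    obtain ⟨j, -, hj⟩ := mem_map.1 h
    have hj' := e.injective hj
    obtain rfl : j = i := congrArg Prod.fst hj'
    exact (mem_filter.1 hi).2 (congrArg Prod.snd hj').symm

end Code

/-! ### Configurations forced by two-page requests -/

section Config

variable {k : ℕ} {P : Type*}

theorem retrievals_triangle (C C' C'' : Config k P) :
    retrievals C C'' ≤ retrievals C C' + retrievals C' C'' := by
  classical
  unfold retrievals
  refine (card_le_card fun s hs => ?_).trans (card_union_le _ _)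
  simp only [mem_union, mem_filter, mem_univ, true_and] at hs ⊢
  by_cases h : C' s = C'' s
  · exact Or.inl (by rw [h]; exact hs)
  · exact Or.inr ⟨hs.1, h⟩

theorem retrievals_self (C : Config k P) : retrievals C C = 0 := by
  simp [retrievals]

theorem retrievals_le (C C' : Config k P) : retrievals C C' ≤ k := by
  classical
  exact (card_filter_le _ _).trans (by simp)

theorem Config.Satisfies.of_retrievals_eq_zero {F : Set (Finset (Fin k))} {C C' : Config k P}
    {r : Request F P} (h : C'.Satisfies r) (h0 : retrievals C C' = 0) : C.Satisfies r := by
  classical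
  obtain ⟨s, hs, hC⟩ := h
  refine ⟨s, hs, ?_⟩
  unfold retrievals at h0
  rw [card_eq_zero, filter_eq_empty_iff] at h0
  have := h0 (mem_univ s)
  simp only [hC, ne_eq, reduceCtorEq, not_false_eq_true, true_and, not_not] at this
  exact this

open Classical in
/-- The configuration on the slots in `U` with page `p` on `A` and page `q` on `U \ A`. -/
def twoPageConfig (p q : P) (U A : Finset (Fin k)) : Config k P :=
  fun s => if s ∈ A then some p else if s ∈ U then some q else none

/-- A configuration has to agree on `U` with a member of a sparse family of balanced two-page
configurations as soon as it satisfies all two-page requests that the whole family satisfies. -/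
theorem exists_eqOn_twoPageConfig {m : ℕ} (hm : 1 ≤ m) {p q : P} (hpq : p ≠ q)
    {U : Finset (Fin k)} (hU : U.card = 2 * m) {𝓕 : Set (Finset (Fin k))}
    (hsub : ∀ A ∈ 𝓕, A ⊆ U) (hcard : ∀ A ∈ 𝓕, A.card = m)
    (hsep : ∀ A ∈ 𝓕, ∀ B ∈ 𝓕, (A \ B).card ≠ 1) (C : Config k P)
    (hC : ∀ r : Request (oneOutOf k m) P, (r.page = p ∨ r.page = q) →
      (∀ A ∈ 𝓕, (twoPageConfig p q U A).Satisfies r) → C.Satisfies r) :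
    ∃ A ∈ 𝓕, ∀ s ∈ U, C s = twoPageConfig p q U A s := by
  classical
  set X := U.filter fun s => C s = some p with hX
  set Y := U.filter fun s => C s = some q with hY
  have hXU : X ⊆ U := filter_subset _ _
  have hYU : Y ⊆ U := filter_subset _ _
  -- Among balanced configurations only that of `S` fails `(p, U \ S)`, and likewise `(q, S)` below.
  -- If `S ∉ 𝓕`, both requests are common to the family.
  have hp : ∀ S ⊆ U, S.card = m → S ∉ 𝓕 → ¬ X ⊆ S := by
    intro S hSU hS hSF hXS
    have hc : (U \ S).card = m := by rw [card_sdiff_of_subset hSU]; omega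
    obtain ⟨s, hs, hCs⟩ := hC ⟨p, U \ S, hc⟩ (Or.inl rfl) (by
      intro A hA
      have : ¬ A ⊆ S := fun h => hSF (eq_of_subset_of_card_le h (by rw [hS, hcard A hA]) ▸ hA)
      obtain ⟨s, hsA, hsS⟩ := not_subset.1 this
      exact ⟨s, mem_sdiff.2 ⟨hsub A hA hsA, hsS⟩, by simp [twoPageConfig, hsA]⟩)
    obtain ⟨hsU, hsS⟩ := mem_sdiff.1 hs
    exact hsS (hXS (mem_filter.2 ⟨hsU, hCs⟩))
  have hq : ∀ S ⊆ U, S.card = m → S ∉ 𝓕 → ¬ Disjoint Y S := by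
    intro S hSU hS hSF hYS
    obtain ⟨s, hs, hCs⟩ := hC ⟨q, S, hS⟩ (Or.inr rfl) (by
      intro A hA
      have : ¬ S ⊆ A := fun h => hSF (eq_of_subset_of_card_le h (by rw [hS, hcard A hA]) ▸ hA)
      obtain ⟨s, hsS, hsA⟩ := not_subset.1 this
      exact ⟨s, hsS, by simp [twoPageConfig, hsA, hSU hsS]⟩)
    exact disjoint_left.1 hYS (mem_filter.2 ⟨hSU hs, hCs⟩) hs
  -- A set with fewer than `m` slots extends to two `m`-sets one exchange apart; by `hsep` they, or
  -- their complements, cannot both lie in `𝓕`.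
  have swap : ∀ Z ⊆ U, Z.card < m → ∃ S T : Finset (Fin k), Z ⊆ S ∧ Z ⊆ T ∧ S ⊆ U ∧ T ⊆ U ∧
      S.card = m ∧ T.card = m ∧ (S \ T).card = 1 ∧ ((U \ T) \ (U \ S)).card = 1 := by
    intro Z hZU hZ
    obtain ⟨W, hZW, hWU, hW⟩ := exists_subsuperset_card_eq hZU (n := m - 1) (by omega) (by omega)
    have : 1 < (U \ W).card := by rw [card_sdiff_of_subset hWU]; omega
    obtain ⟨a, ha, b, hb, hab⟩ := one_lt_card.1 this
    rw [mem_sdiff] at ha hb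
    have e1 : insert a W \ insert b W = {a} := by
      ext t; simp only [mem_sdiff, mem_insert, mem_singleton]; grind
    have e2 : (U \ insert b W) \ (U \ insert a W) = {a} := by
      ext t; simp only [mem_sdiff, mem_insert, mem_singleton]; grind
    refine ⟨insert a W, insert b W, hZW.trans (subset_insert _ _), hZW.trans (subset_insert _ _),
      insert_subset ha.1 hWU, insert_subset hb.1 hWU, ?_, ?_, by rw [e1]; simp, by rw [e2]; simp⟩
    · rw [card_insert_of_notMem ha.2]; omega
    · rw [card_insert_of_notMem hb.2]; omega
  have hXm : m ≤ X.card := by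
    by_contra! h
    obtain ⟨S, T, hXS, hXT, hSU, hTU, hS, hT, h1, -⟩ := swap X hXU h
    refine hsep S ?_ T ?_ h1
    · by_contra hn; exact hp S hSU hS hn hXS
    · by_contra hn; exact hp T hTU hT hn hXT
  have hYm : m ≤ Y.card := by
    by_contra! h
    obtain ⟨S, T, hYS, hYT, hSU, hTU, hS, hT, -, h1⟩ := swap Y hYU h
    refine hsep (U \ T) ?_ (U \ S) ?_ h1
    · by_contra hn
      exact hq _ sdiff_subset (by rw [card_sdiff_of_subset hTU]; omega) hn
        (disjoint_sdiff.mono_left hYT)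
    · by_contra hn
      exact hq _ sdiff_subset (by rw [card_sdiff_of_subset hSU]; omega) hn
        (disjoint_sdiff.mono_left hYS)
  have hdisj : Disjoint X Y := by
    refine disjoint_filter.2 fun s _ h1 h2 => hpq ?_
    exact Option.some.inj (h1.symm.trans h2)
  have hcu := card_union_of_disjoint hdisj
  have hle := card_le_card (union_subset hXU hYU)
  have hXY : X ∪ Y = U := eq_of_subset_of_card_le (union_subset hXU hYU) (by omega)
  refine ⟨X, ?_, fun s hs => ?_⟩
  · by_contra hn; exact hp X hXU (by omega) hn Subset.rfl
  · by_cases hsX : s ∈ X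
    · simpa [twoPageConfig, hsX] using (mem_filter.1 hsX).2
    · have hsY : s ∈ Y := (mem_union.1 (hXY ▸ hs)).resolve_left hsX
      simpa [twoPageConfig, hsX, hs] using (mem_filter.1 hsY).2

-- On a slot of `A \ B`, `D` holds `p` and `E` holds `q`, so `C` differs from at least one of them.
open Classical in
theorem le_retrievals_add_retrievals {p q : P} (hpq : p ≠ q) {U A B : Finset (Fin k)}
    (hA : A ⊆ U) {C D E : Config k P}
    (hD : ∀ s ∈ U, D s = twoPageConfig p q U A s) (hE : ∀ s ∈ U, E s = twoPageConfig p q U B s) :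
    (A \ B).card ≤ retrievals C D + retrievals C E := by
  unfold retrievals
  refine (card_le_card fun s hs => ?_).trans (card_union_le _ _)
  obtain ⟨hsA, hsB⟩ := mem_sdiff.1 hs
  have h1 := hD s (hA hsA)
  have h2 := hE s (hA hsA)
  simp only [twoPageConfig, hsA, hsB, hA hsA, if_true, if_false] at h1 h2
  simp only [mem_union, mem_filter, mem_univ, true_and, h1, h2]
  by_cases h : C s = some p
  · right; simp [h, hpq]
  · left; simp [h]

end Config

/-! ### Costs of online algorithms and offline solutions -/

section Algorithm

variable {k : ℕ} {F : Set (Finset (Fin k))} {P : Type*}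

theorem OnlineAlgorithm.cost_append_singleton (A : OnlineAlgorithm F P) (σ : List (Request F P))
    (r : Request F P) :
    A.cost (σ ++ [r]) = A.cost σ + retrievals (A.config σ) (A.config (σ ++ [r])) := by
  unfold OnlineAlgorithm.cost totalCost
  rw [List.length_append, List.length_singleton, sum_range_succ]
  congr 1
  · refine sum_congr rfl fun t ht => ?_
    have ht := mem_range.1 ht
    simp only
    rw [List.take_append_of_le_length (by omega), List.take_append_of_le_length (by omega)]
  · congr 2
    · simp
    · exact congrArg A.config (List.take_of_length_le (by simp))

theorem OnlineAlgorithm.cost_add_retrievals_le (A : OnlineAlgorithm F P)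
    (σ τ : List (Request F P)) :
    A.cost σ + retrievals (A.config σ) (A.config (σ ++ τ)) ≤ A.cost (σ ++ τ) := by
  induction τ using List.reverseRecOn with
  | nil => simp [retrievals_self]
  | append_singleton τ r ih =>
    rw [← List.append_assoc, A.cost_append_singleton]
    have := retrievals_triangle (A.config σ) (A.config (σ ++ τ)) (A.config (σ ++ τ ++ [r]))
    omega

/-- Without retrievals pages can only be dropped, so the page serving `r` was already in place. -/
theorem OnlineAlgorithm.satisfies_of_cost_append_le (A : OnlineAlgorithm F P)
    {σ τ : List (Request F P)} (h : A.cost (σ ++ τ) ≤ A.cost σ) {r : Request F P} (hr : r ∈ τ) :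
    (A.config σ).Satisfies r := by
  obtain ⟨τ₁, τ₂, rfl⟩ := List.append_of_mem hr
  have h1 := A.cost_add_retrievals_le σ (τ₁ ++ [r])
  have h2 := A.cost_add_retrievals_le (σ ++ (τ₁ ++ [r])) τ₂
  rw [List.append_assoc, List.append_assoc, List.singleton_append] at h2
  have h3 : (A.config (σ ++ (τ₁ ++ [r]))).Satisfies r := by
    rw [← List.append_assoc]; exact A.satisfies _ _
  exact h3.of_retrievals_eq_zero (by omega)

/-- If a list of requests is repeated `M` times, the algorithm makes `M` retrievals or visits a
configuration that satisfies the whole list. -/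
theorem OnlineAlgorithm.cost_append_replicate (A : OnlineAlgorithm F P)
    (σ l : List (Request F P)) (M : ℕ) :
    A.cost σ + M ≤ A.cost (σ ++ (List.replicate M l).flatten) ∨
      ∃ C : Config k P, (∀ r ∈ l, C.Satisfies r) ∧
        A.cost σ + retrievals (A.config σ) C ≤ A.cost (σ ++ (List.replicate M l).flatten) := by
  induction M with
  | zero => simp
  | succ M ih =>
    rw [List.replicate_succ', List.flatten_append, ← List.append_assoc, List.flatten_singleton]
    set τ := (List.replicate M l).flatten
    have h1 := A.cost_add_retrievals_le (σ ++ τ) l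
    rcases ih with h | ⟨C, hC, h⟩
    · by_cases h2 : A.cost (σ ++ τ ++ l) ≤ A.cost (σ ++ τ)
      · refine Or.inr ⟨A.config (σ ++ τ), fun r hr => A.satisfies_of_cost_append_le h2 hr, ?_⟩
        have := A.cost_add_retrievals_le σ τ
        omega
      · left; omega
    · exact Or.inr ⟨C, hC, by omega⟩

theorem OnlineAlgorithm.measurable_cost (σ : List (Request F P)) :
    Measurable fun A : OnlineAlgorithm F P => A.cost σ := by
  rw [measurable_iff_comap_le]
  exact le_iSup (fun σ : List (Request F P) =>
    MeasurableSpace.comap (fun A : OnlineAlgorithm F P => A.cost σ) ⊤) σ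

/-- The expected cost of a randomized online algorithm. -/
def expectedCost (μ : Measure (OnlineAlgorithm F P)) (σ : List (Request F P)) : ℝ≥0∞ :=
  ∫⁻ A, (A.cost σ : ℝ≥0∞) ∂μ

/-- Averaging: the bound holds for each deterministic algorithm, hence in expectation, and the
larger of the two expectations gains at least half of `d`. -/
theorem expectedCost_add_le_or (μ : Measure (OnlineAlgorithm F P)) [IsProbabilityMeasure μ]
    {σ τ₁ τ₂ : List (Request F P)} {d : ℕ}
    (h : ∀ A : OnlineAlgorithm F P, 2 * A.cost σ + d ≤ A.cost τ₁ + A.cost τ₂) :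
    expectedCost μ σ + d / 2 ≤ expectedCost μ τ₁ ∨
      expectedCost μ σ + d / 2 ≤ expectedCost μ τ₂ := by
  have meas (σ : List (Request F P)) :
      Measurable fun A : OnlineAlgorithm F P => (A.cost σ : ℝ≥0∞) :=
    (measurable_from_top (f := fun n : ℕ => (n : ℝ≥0∞))).comp
      (OnlineAlgorithm.measurable_cost σ)
  have hsum : 2 * expectedCost μ σ + d ≤ expectedCost μ τ₁ + expectedCost μ τ₂ := by
    unfold expectedCost
    rw [← lintegral_add_left (meas τ₁), ← lintegral_const_mul _ (meas σ)]
    calc (∫⁻ A, 2 * (A.cost σ : ℝ≥0∞) ∂μ) + d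
        = ∫⁻ A, (2 * (A.cost σ : ℝ≥0∞) + d) ∂μ := by
          rw [lintegral_add_right _ measurable_const]; simp
      _ ≤ _ := lintegral_mono fun A => by
          have := (Nat.cast_le (α := ℝ≥0∞)).2 (h A)
          push_cast at this
          exact this
  by_contra! hlt
  refine absurd hsum (not_le.2 ((ENNReal.add_lt_add hlt.1 hlt.2).trans_eq ?_))
  rw [add_add_add_comm, ENNReal.add_halves, two_mul]

theorem exists_solution_append {σ τ : List (Request F P)} {D : ℕ → Config k P}
    (hD : IsSolution σ D) (E : Config k P) (hE : ∀ r ∈ τ, E.Satisfies r) :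
    ∃ D', IsSolution (σ ++ τ) D' ∧
      totalCost D' (σ ++ τ).length ≤ totalCost D σ.length + k := by
  let D' : ℕ → Config k P := fun t => if t ≤ σ.length then D t else E
  refine ⟨D', ⟨by simp [D', hD.1], fun t ht => ?_⟩, ?_⟩
  · by_cases h : t < σ.length
    · rw [List.getElem_append_left h]
      simpa [D', Nat.succ_le_of_lt h] using hD.2 t h
    · rw [List.getElem_append_right (by omega)]
      have : ¬ t + 1 ≤ σ.length := by omega
      simpa [D', this] using hE _ (List.getElem_mem _)
  · unfold totalCost
    rw [List.length_append, sum_range_add]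
    refine add_le_add (sum_le_sum fun t ht => ?_) ?_
    · have ht := mem_range.1 ht
      simp [D', ht.le, Nat.succ_le_of_lt ht]
    · rcases Nat.eq_zero_or_pos τ.length with h | h
      · simp [h]
      · rw [← Nat.succ_pred_eq_of_pos h, Nat.succ_eq_add_one, sum_range_succ']
        have : ∀ t, retrievals (D' (σ.length + (t + 1))) (D' (σ.length + (t + 1) + 1)) = 0 := by
          intro t
          simp only [D']
          rw [if_neg (by omega), if_neg (by omega), retrievals_self]
        simp only [this, sum_const_zero, zero_add]
        exact retrievals_le _ _

end Algorithm

/-! ### The adversary and the competitive lower bound -/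

section Adversary

variable {k m d : ℕ} {P : Type*} {p q : P} {U : Finset (Fin k)}
  {A : (Fin d → Bool) → Finset (Fin k)}

theorem exists_list_mem_iff {F : Set (Finset (Fin k))} (p q : P) (𝓓 : Set (Config k P)) :
    ∃ l : List (Request F P), ∀ r, r ∈ l ↔
      (r.page = p ∨ r.page = q) ∧ ∀ D ∈ 𝓓, D.Satisfies r := by
  have hfin : {r : Request F P | r.page = p ∨ r.page = q}.Finite := by
    refine Set.Finite.of_finite_image (f := fun r => (r.page, r.slots))
      (((Set.toFinite {p, q}).prod (Set.finite_univ (α := Finset (Fin k)))).subset ?_) ?_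
    · rintro _ ⟨r, hr, rfl⟩
      exact ⟨hr, trivial⟩
    · rintro ⟨p, S, h⟩ - ⟨p', S', h'⟩ - he
      simp only [Prod.mk.injEq] at he
      obtain ⟨rfl, rfl⟩ := he
      rfl
  have hfin' : {r : Request F P | (r.page = p ∨ r.page = q) ∧ ∀ D ∈ 𝓓, D.Satisfies r}.Finite :=
    hfin.subset fun r hr => hr.1
  exact ⟨hfin'.toFinset.toList, fun r => by simp⟩

/-- All requests to two pages that are satisfied by all the given configurations. -/
def commonRequests {F : Set (Finset (Fin k))} (p q : P) (𝓓 : Set (Config k P)) :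
    List (Request F P) :=
  (exists_list_mem_iff p q 𝓓).choose

theorem mem_commonRequests {F : Set (Finset (Fin k))} {𝓓 : Set (Config k P)} {r : Request F P} :
    r ∈ commonRequests p q 𝓓 ↔ (r.page = p ∨ r.page = q) ∧ ∀ D ∈ 𝓓, D.Satisfies r :=
  (exists_list_mem_iff p q 𝓓).choose_spec r

/-- The codewords that agree with `x` in the first `j` bits. -/
def prefixFamily (A : (Fin d → Bool) → Finset (Fin k)) (x : Fin d → Bool) (j : ℕ) :
    Set (Finset (Fin k)) :=
  A '' {y | ∀ i : Fin d, (i : ℕ) < j → y i = x i}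

/-- The requests that force an algorithm into a codeword that agrees with `x` in the first `j`
bits, repeated `d` times. -/
def adversaryRound (m : ℕ) (p q : P) (U : Finset (Fin k)) (A : (Fin d → Bool) → Finset (Fin k))
    (x : Fin d → Bool) (j : ℕ) : List (Request (oneOutOf k m) P) :=
  (List.replicate d (commonRequests p q (twoPageConfig p q U '' prefixFamily A x j))).flatten

/-- The rounds for the first `j` bits of `x`. -/
def adversaryPhase (m : ℕ) (p q : P) (U : Finset (Fin k)) (A : (Fin d → Bool) → Finset (Fin k))
    (x : Fin d → Bool) (j : ℕ) : List (Request (oneOutOf k m) P) :=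
  ((List.range j).map fun i => adversaryRound m p q U A x (i + 1)).flatten

theorem adversaryPhase_succ (x : Fin d → Bool) (j : ℕ) :
    adversaryPhase m p q U A x (j + 1) =
      adversaryPhase m p q U A x j ++ adversaryRound m p q U A x (j + 1) := by
  simp [adversaryPhase, List.range_succ]

theorem prefixFamily_congr {x y : Fin d → Bool} {j : ℕ} (h : ∀ i : Fin d, (i : ℕ) < j → x i = y i) :
    prefixFamily A x j = prefixFamily A y j := by
  unfold prefixFamily
  congr 1
  ext z
  exact forall₂_congr fun i hi => by rw [h i hi]

theorem adversaryPhase_congr {x y : Fin d → Bool} {j : ℕ}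
    (h : ∀ i : Fin d, (i : ℕ) < j → x i = y i) :
    adversaryPhase m p q U A x j = adversaryPhase m p q U A y j := by
  unfold adversaryPhase adversaryRound
  congr 1
  refine List.map_congr_left fun i hi => ?_
  rw [prefixFamily_congr fun t ht => h t (by have := List.mem_range.1 hi; omega)]

theorem satisfies_of_mem_adversaryPhase {x : Fin d → Bool} {j : ℕ}
    {r : Request (oneOutOf k m) P} (hr : r ∈ adversaryPhase m p q U A x j) :
    (twoPageConfig p q U (A x)).Satisfies r := by
  simp only [adversaryPhase, adversaryRound, List.mem_flatten, List.mem_map] at hr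
  obtain ⟨_, ⟨i, -, rfl⟩, hr⟩ := hr
  obtain ⟨l, hl, hr⟩ := List.mem_flatten.1 hr
  rw [List.eq_of_mem_replicate hl] at hr
  exact (mem_commonRequests.1 hr).2 _ ⟨A x, ⟨x, fun _ _ => rfl, rfl⟩, rfl⟩

/-- The code assumptions of the adversary. -/
structure IsSlotCode (m : ℕ) (U : Finset (Fin k)) (A : (Fin d → Bool) → Finset (Fin k)) :
    Prop where
  card_slots : U.card = 2 * m
  subset : ∀ x, A x ⊆ U
  card : ∀ x, (A x).card = m
  separated : ∀ x y, x ≠ y → d ≤ (A x \ A y).card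

theorem IsSlotCode.cost_round (hA : IsSlotCode m U A) (hm : 1 ≤ m) (hd : 2 ≤ d) (hpq : p ≠ q)
    (𝔸 : OnlineAlgorithm (oneOutOf k m) P) (σ : List (Request (oneOutOf k m) P))
    (x : Fin d → Bool) (j : ℕ) :
    𝔸.cost σ + d ≤ 𝔸.cost (σ ++ adversaryRound m p q U A x j) ∨
      ∃ C : Config k P, (∃ y, (∀ i : Fin d, (i : ℕ) < j → y i = x i) ∧
          ∀ s ∈ U, C s = twoPageConfig p q U (A y) s) ∧
        𝔸.cost σ + retrievals (𝔸.config σ) C ≤ 𝔸.cost (σ ++ adversaryRound m p q U A x j) := by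
  refine (𝔸.cost_append_replicate σ _ d).imp id ?_
  rintro ⟨C, hC, hcost⟩
  refine ⟨C, ?_, hcost⟩
  obtain ⟨_, ⟨y, hy, rfl⟩, h⟩ := exists_eqOn_twoPageConfig hm hpq hA.card_slots
    (𝓕 := prefixFamily A x j) (by rintro _ ⟨y, -, rfl⟩; exact hA.subset y)
    (by rintro _ ⟨y, -, rfl⟩; exact hA.card y)
    -- Distinct codewords differ in at least `d ≥ 2` slots and equal ones in none, so the difference
    -- is never a single slot.
    (by
      rintro _ ⟨y, -, rfl⟩ _ ⟨z, -, rfl⟩ h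
      by_cases hyz : y = z
      · simp [hyz] at h
      · have := hA.separated y z hyz
        omega) C
    (fun r hr hall => hC r (mem_commonRequests.2 ⟨hr, by rintro _ ⟨B, hB, rfl⟩; exact hall B hB⟩))
  exact ⟨y, hy, h⟩

/-- Either one branch alone pays `d`, or the branches reach distinct codewords, whose separation
bounds the two moves together. -/
theorem IsSlotCode.cost_two_rounds (hA : IsSlotCode m U A) (hm : 1 ≤ m) (hd : 2 ≤ d)
    (hpq : p ≠ q) (𝔸 : OnlineAlgorithm (oneOutOf k m) P)
    (σ : List (Request (oneOutOf k m) P)) {x y : Fin d → Bool} {j : ℕ} (i : Fin d)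
    (hi : (i : ℕ) < j) (hxy : x i ≠ y i) :
    2 * 𝔸.cost σ + d ≤ 𝔸.cost (σ ++ adversaryRound m p q U A x j) +
      𝔸.cost (σ ++ adversaryRound m p q U A y j) := by
  have h1 := 𝔸.cost_add_retrievals_le σ (adversaryRound m p q U A x j)
  have h2 := 𝔸.cost_add_retrievals_le σ (adversaryRound m p q U A y j)
  rcases hA.cost_round hm hd hpq 𝔸 σ x j with h | ⟨C, ⟨x', hx', hC⟩, h⟩
  · omega
  rcases hA.cost_round hm hd hpq 𝔸 σ y j with h' | ⟨D, ⟨y', hy', hD⟩, h'⟩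
  · omega
  have hne : x' ≠ y' := by
    rintro rfl
    exact hxy ((hx' i hi).symm.trans (hy' i hi))
  have h3 := hA.separated _ _ hne
  have h4 := le_retrievals_add_retrievals hpq (hA.subset x') (C := 𝔸.config σ) hC hD
  omega

theorem IsSlotCode.exists_phase (hA : IsSlotCode m U A) (hm : 1 ≤ m) (hd : 2 ≤ d) (hpq : p ≠ q)
    (μ : Measure (OnlineAlgorithm (oneOutOf k m) P)) [IsProbabilityMeasure μ]
    (σ : List (Request (oneOutOf k m) P)) (j : ℕ) (hj : j ≤ d) :
    ∃ x, expectedCost μ σ + j * (d / 2) ≤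
      expectedCost μ (σ ++ adversaryPhase m p q U A x j) := by
  induction j with
  | zero => exact ⟨fun _ => false, by simp [adversaryPhase]⟩
  | succ j ih =>
    obtain ⟨x, hx⟩ := ih (by omega)
    let i : Fin d := ⟨j, by omega⟩
    -- Flipping bit `j` leaves the first `j` rounds unchanged, so both branches share their history.
    let y := Function.update x i (!x i)
    have hphase : adversaryPhase m p q U A y j = adversaryPhase m p q U A x j := by
      refine adversaryPhase_congr fun t ht => ?_
      have : t ≠ i := by rintro rfl; exact lt_irrefl _ ht
      simp [y, this]
    have hstep (z : Fin d → Bool) (hz : adversaryPhase m p q U A z j = adversaryPhase m p q U A x j)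
        (h : expectedCost μ (σ ++ adversaryPhase m p q U A x j) + d / 2 ≤
          expectedCost μ (σ ++ adversaryPhase m p q U A x j ++
            adversaryRound m p q U A z (j + 1))) :
        expectedCost μ σ + (j + 1 : ℕ) * (d / 2) ≤
          expectedCost μ (σ ++ adversaryPhase m p q U A z (j + 1)) := by
      rw [adversaryPhase_succ, hz, ← List.append_assoc]
      refine le_trans ?_ h
      push_cast
      rw [add_mul, one_mul, ← add_assoc]
      gcongr
    rcases expectedCost_add_le_or μ fun 𝔸 => hA.cost_two_rounds hm hd hpq 𝔸
      (σ ++ adversaryPhase m p q U A x j) (x := x) (y := y) (j := j + 1) i (by simp [i])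
      (by simp [y]) with h | h
    · exact ⟨x, hstep x rfl h⟩
    · exact ⟨y, hstep y hphase h⟩

theorem IsSlotCode.exists_requests (hA : IsSlotCode m U A) (hm : 1 ≤ m) (hd : 2 ≤ d) (hpq : p ≠ q)
    (μ : Measure (OnlineAlgorithm (oneOutOf k m) P)) [IsProbabilityMeasure μ] (L : ℕ) :
    ∃ σ : List (Request (oneOutOf k m) P),
      L * (d * (d / 2)) ≤ expectedCost μ σ ∧
      ∃ D, IsSolution σ D ∧ totalCost D σ.length ≤ L * k := by
  induction L with
  | zero => exact ⟨[], by simp, fun _ _ => none, ⟨rfl, by simp⟩, by simp [totalCost]⟩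
  | succ L ih =>
    obtain ⟨σ, hσ, D, hD, hcost⟩ := ih
    obtain ⟨x, hx⟩ := hA.exists_phase hm hd hpq μ σ d le_rfl
    obtain ⟨D', hD', hcost'⟩ := exists_solution_append hD (twoPageConfig p q U (A x))
      (τ := adversaryPhase m p q U A x d) fun r hr => satisfies_of_mem_adversaryPhase hr
    refine ⟨_, le_trans ?_ hx, D', hD', hcost'.trans (by rw [add_mul, one_mul]; omega)⟩
    push_cast
    rw [add_mul, one_mul]
    gcongr

theorem IsSlotCode.le_of_isCompetitive (hA : IsSlotCode m U A) (hm : 1 ≤ m) (hd : 2 ≤ d)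
    (hpq : p ≠ q) {μ : Measure (OnlineAlgorithm (oneOutOf k m) P)} [IsProbabilityMeasure μ]
    {r : ℝ≥0} (hr : IsCompetitive μ r) : (d : ℝ) * (d / 2) ≤ r * k := by
  obtain ⟨b, hb⟩ := hr
  by_contra! hlt
  -- Enough phases outweigh the additive constant `b`.
  obtain ⟨L, hL⟩ := exists_nat_gt ((b : ℝ) / (d * (d / 2) - r * k))
  obtain ⟨σ, hσ, D, hD, hcost⟩ := hA.exists_requests hm hd hpq μ L
  have hopt : (opt σ : ℝ≥0∞) ≤ ((L * k : ℕ) : ℝ≥0∞) := by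
    have : opt σ ≤ ((L * k : ℕ) : ℕ∞) :=
      (iInf₂_le D hD).trans (by exact_mod_cast hcost)
    exact_mod_cast ENat.toENNReal_le.2 this
  have h : (L : ℝ≥0∞) * (d * (d / 2)) ≤ r * ((L * k : ℕ) : ℝ≥0∞) + b :=
    hσ.trans ((hb σ).trans (by gcongr))
  have h' : (L : ℝ≥0) * (d * (d / 2)) ≤ r * ((L * k : ℕ) : ℝ≥0) + b := by
    have e : (((L : ℝ≥0) * (d * (d / 2)) : ℝ≥0) : ℝ≥0∞) = L * (d * (d / 2)) := by
      rw [ENNReal.coe_mul, ENNReal.coe_mul, ENNReal.coe_div two_ne_zero]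
      simp
    rw [← ENNReal.coe_le_coe, e]
    exact_mod_cast h
  have h'' : (L : ℝ) * (d * (d / 2)) ≤ r * (L * k) + b := by exact_mod_cast h'
  rw [div_lt_iff₀ (by linarith)] at hL
  linarith

end Adversary

end SlotPaging

end

theorem mainTheorem7 :
    ∃ c : ℝ≥0, 0 < c ∧ ∃ k₀ : ℕ, ∀ k : ℕ, k₀ ≤ k → ∀ (P : Type*) [Nontrivial P],
      (c : ℝ≥0∞) * (k : ℝ≥0∞) ≤
        SlotPaging.optimalRandomizedRatio (SlotPaging.oneOutOf k (k / 2)) P := by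
  -- With `d = k / 10` rounded down, `k ≥ 20` gives `d ≥ 2` and `d ≥ k / 20`, hence `d ^ 2 / 2 ≥ k ^
  -- 2 / 800`.
  refine ⟨1 / 800, by norm_num, 20, fun k hk P _ => ?_⟩
  obtain ⟨p, q, hpq⟩ := exists_pair_ne P
  obtain ⟨U, A, hU, hsub, hcard, hsep⟩ :=
    SlotPaging.exists_slotCode (k := k) (m := k / 2) (d := k / 10) (by omega) (by omega)
  have hA : SlotPaging.IsSlotCode (k / 2) U A := ⟨hU, hsub, hcard, hsep⟩
  refine le_iInf₂ fun r hr => ?_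
  obtain ⟨μ, hμ, hcomp⟩ := hr
  have h := hA.le_of_isCompetitive (by omega) (by omega) hpq hcomp
  have hk' : (k : ℝ) ≤ 20 * ((k / 10 : ℕ) : ℝ) := by
    exact_mod_cast (by omega : k ≤ 20 * (k / 10))
  have hpos : (0 : ℝ) < k := by exact_mod_cast (by omega : 0 < k)
  have hreal : (1 / 800 : ℝ) * k ≤ r := by
    refine le_of_mul_le_mul_right ?_ hpos
    nlinarith
  have hnn : (1 / 800 : ℝ≥0) * k ≤ r := by
    rw [← NNReal.coe_le_coe]
    push_cast
    exact hreal
  exact_mod_cast ENNReal.coe_le_coe.2 hnn
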